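/- Let $\mathbb{O}$ denote the octonions: the real algebra $\mathbb{H}\oplus\mathbb{H}$ ($\mathbb{H}$ the quaternions) with product $(p,q)(r,s)=(pr-\overline{s}q,\; sp+q\overline{r})$, unit $1=(1,0)$, conjugation $\overline{(p,q)}=(\overline{p},-q)$ and norm $|(p,q)|=(|p|^2+|q|^2)^{1/2}$; as a normed real vector space, $\mathbb{O}$ is identified with Euclidean space $\mathbb{R}^8$. Let $\mathbb{B}_8=\{x\in\mathbb{O}:|x|<1\}$ be its open unit ball. Theorem. Let $f:\mathbb{B}_8\to\mathbb{O}$ be a harmonic function (that is, $f$ is of class $C^2$ and $\Delta f=0$ on $\mathbb{B}_8$, where $\Delta$ is the Laplace operator of $\mathbb{R}^8$) with $|f(x)|\le 1$ for all $x\in\mathbb{B}_8$. If $f(a)=0$ for some $a\in\mathbb{B}_8$, then $$|f(x)|\le\frac{(1+|a|)^{6}}{\sqrt[8]{2}-1}\,\frac{|x-a|}{|1-\overline{a}x|^{7}}\qquad\text{for all }x\in\mathbb{B}_8 .$$ -/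

import Mathlib

open scoped Quaternion

/-- The octonions `𝕆 = ℍ ⊕ ℍ` (Cayley-Dickson doubling of Hamilton's quaternions), as a real
vector space with the Euclidean norm `|(p, q)|² = |p|² + |q|²` of `ℝ⁸`. -/
def Octonion : Type := WithLp 2 (ℍ[ℝ] × ℍ[ℝ])

namespace Octonion

noncomputable instance : NormedAddCommGroup Octonion :=
  inferInstanceAs (NormedAddCommGroup (WithLp 2 (ℍ[ℝ] × ℍ[ℝ])))

noncomputable instance : InnerProductSpace ℝ Octonion :=
  inferInstanceAs (InnerProductSpace ℝ (WithLp 2 (ℍ[ℝ] × ℍ[ℝ])))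

instance : FiniteDimensional ℝ Octonion :=
  inferInstanceAs (FiniteDimensional ℝ (WithLp 2 (ℍ[ℝ] × ℍ[ℝ])))

/-- The octonion `p + q ℓ` with quaternion components `p` and `q`. -/
def mk (p q : ℍ[ℝ]) : Octonion := WithLp.toLp 2 (p, q)

/-- The first quaternion component. -/
def fst (x : Octonion) : ℍ[ℝ] := (WithLp.ofLp x).1

/-- The second quaternion component. -/
def snd (x : Octonion) : ℍ[ℝ] := (WithLp.ofLp x).2

/-- The unit octonion `e₀ = 1`. -/
noncomputable instance : One Octonion := ⟨mk 1 0⟩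

/-- Octonion multiplication: `(p, q) (r, s) = (p r - s̄ q, s p + q r̄)`. -/
noncomputable instance : Mul Octonion :=
  ⟨fun x y => mk (x.fst * y.fst - star y.snd * x.snd) (y.snd * x.fst + x.snd * star y.fst)⟩

/-- Octonion conjugation: the conjugate of `(p, q)` is `(p̄, -q)`. -/
noncomputable instance : Star Octonion := ⟨fun x => mk (star x.fst) (-x.snd)⟩

end Octonion

/-! Pairing `f` with the unit vector in the direction of `f x` reduces the bound to a real harmonic
function `u` with `|u| ≤ 1` and `u a = 0`. Octonion multiplication enters only through `|1 - āx|² =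
|x - a|² + (1 - |a|²)(1 - |x|²)`.

If `a = 0`, this is a Schwarz lemma `|u x| ≤ 10 |x|`: Harnack's inequality, from the mean value
property, is applied to `1 ± u`. The constant suffices because `10 ≤ 1 / (2^(1/8) - 1)`.

If `a ≠ 0`, inversion in the sphere with center `c = a / |a|²` and squared radius `|a|⁻² - 1`
preserves the unit ball and swaps `0` and `a`. The Kelvin transform `|z - c|⁻⁶ u(z*)`, where `z*` is
the inverse point of `z`, is harmonic in dimension 8, vanishes at `0` and is bounded by `(|a|⁻¹ -
1)⁻⁶`. The Schwarz lemma for it at the inverse point of `x` gives the theorem (`laplacian_kelvin`,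
`pow_mul_le_of_harmonicOnNhd`, `abs_le_of_harmonicOnNhd_of_apply_eq_zero`). -/

/-! ### Harmonicity of the Kelvin transform. -/

section Kelvin

open InnerProductSpace Filter Topology EuclideanGeometry
open scoped RealInnerProductSpace Laplacian

variable {E : Type*} [NormedAddCommGroup E] [InnerProductSpace ℝ E]

/-- The second derivative of a `C²` function in the direction `v` is computed along the line
through `x` with direction `v`. -/
theorem fderiv_fderiv_apply_eq_of_hasDerivAt_line {g : E → ℝ} {x v : E} (hg : ContDiffAt ℝ 2 g x)
    {d : ℝ → ℝ} {d' : ℝ} (hd : ∀ᶠ t in 𝓝 (0 : ℝ), HasDerivAt (fun t => g (x + t • v)) (d t) t)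
    (hd' : HasDerivAt d d' 0) : fderiv ℝ (fderiv ℝ g) x v v = d' := by
  have hline (t : ℝ) : HasDerivAt (fun t : ℝ => x + t • v) v t := by
    simpa using ((hasDerivAt_id t).smul_const v).const_add x
  have hcont : Tendsto (fun t : ℝ => x + t • v) (𝓝 0) (𝓝 x) := by
    simpa using (hline 0).continuousAt.tendsto
  have hdiff : ∀ᶠ y in 𝓝 x, DifferentiableAt ℝ g y := by
    filter_upwards [hg.eventually (by simp)] with y hy
    exact hy.differentiableAt (by norm_num)
  have heq : d =ᶠ[𝓝 0] fun t => fderiv ℝ g (x + t • v) v := by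
    filter_upwards [hd, hcont.eventually hdiff] with t ht ht'
    exact ht.unique (ht'.hasFDerivAt.comp_hasDerivAt t (hline t))
  have h2 : HasFDerivAt (fderiv ℝ g) (fderiv ℝ (fderiv ℝ g) x) (x + (0 : ℝ) • v) := by
    simpa using ((hg.fderiv_right (m := 1) (by norm_num)).differentiableAt
      (by norm_num)).hasFDerivAt
  have h3 : HasDerivAt (fun t : ℝ => fderiv ℝ g (x + t • v) v)
      (fderiv ℝ (fderiv ℝ g) x v v) 0 := by
    have h4 : HasDerivAt (fun t : ℝ => fderiv ℝ g (x + t • v)) (fderiv ℝ (fderiv ℝ g) x v) 0 :=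
      h2.comp_hasDerivAt (0 : ℝ) (hline 0)
    exact (ContinuousLinearMap.apply ℝ ℝ v).hasFDerivAt.comp_hasDerivAt (0 : ℝ) h4
  exact h3.unique (hd'.congr_of_eventuallyEq heq.symm)

/-- The Kelvin transform of `u` with respect to the sphere of center `c` and radius `R`, in
dimension `2 m + 2` and up to a constant factor. -/
noncomputable def kelvin (m : ℕ) (c : E) (R : ℝ) (u : E → ℝ) (x : E) : ℝ :=
  ((‖x - c‖ ^ 2)⁻¹) ^ m * u (inversion c R x)

theorem inversion_eq_smul_sub (c : E) (R : ℝ) (x : E) :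
    inversion c R x = c + (R ^ 2 * (‖x - c‖ ^ 2)⁻¹) • (x - c) := by
  simp [inversion, dist_eq_norm, div_eq_mul_inv, mul_pow, add_comm]

theorem ContDiffAt.kelvin {n : ℕ∞} {m : ℕ} {c x : E} {R : ℝ} {u : E → ℝ} (hx : x ≠ c)
    (hu : ContDiffAt ℝ n u (inversion c R x)) : ContDiffAt ℝ n (kelvin m c R u) x := by
  have h0 : ‖x - c‖ ^ 2 ≠ 0 := pow_ne_zero 2 (norm_ne_zero_iff.2 (sub_ne_zero.2 hx))
  have h1 : ContDiffAt ℝ n (fun x => ‖x - c‖ ^ 2) x := (contDiffAt_id.sub contDiffAt_const).norm_sq ℝ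
  exact ((h1.inv h0).pow m).mul
    (hu.comp x (contDiffAt_const.inversion contDiffAt_const contDiffAt_id hx))

/-- Along `t ↦ x + t • v` everything is expressed through `Q = |y + tv|⁻²` and `L = ⟪y, v⟫ + t`,
with `y = x - c`. Since `Q' = -2LQ²` and `L' = 1`, two uses of the product rule suffice. The vector
`w` is the velocity of the inverted line at `t = 0`. -/
theorem fderiv_fderiv_kelvin_apply {m : ℕ} {c x : E} {R : ℝ} {u : E → ℝ} (hx : x ≠ c)
    (hu : ContDiffAt ℝ 2 u (inversion c R x)) {v : E} (hv : ‖v‖ = 1) {q : ℝ}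
    (hq : q = (‖x - c‖ ^ 2)⁻¹) {w : E}
    (hw : w = R ^ 2 • ((-2 * ⟪x - c, v⟫ * q ^ 2) • (x - c) + q • v)) :
    fderiv ℝ (fderiv ℝ (kelvin m c R u)) x v v =
      (-2 * m * q ^ (m + 1) + 4 * m * (m + 1) * ⟪x - c, v⟫ ^ 2 * q ^ (m + 2)) *
          u (inversion c R x)
        - 4 * m * ⟪x - c, v⟫ * q ^ (m + 1) * fderiv ℝ u (inversion c R x) w
        + q ^ m * (fderiv ℝ (fderiv ℝ u) (inversion c R x) w w
          + R ^ 2 * ((-2 * q ^ 2 + 8 * ⟪x - c, v⟫ ^ 2 * q ^ 3) *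
                fderiv ℝ u (inversion c R x) (x - c)
              - 4 * ⟪x - c, v⟫ * q ^ 2 * fderiv ℝ u (inversion c R x) v)) := by
  set y := x - c with hy
  set B : ℝ := ⟪y, v⟫ with hB
  have hy0 : y ≠ 0 := sub_ne_zero.2 hx
  let Q : ℝ → ℝ := fun t => (‖y + t • v‖ ^ 2)⁻¹
  let L : ℝ → ℝ := fun t => B + t
  let γ : ℝ → E := fun t => c + (R ^ 2 * Q t) • (y + t • v)
  let γ' : ℝ → E := fun t => R ^ 2 • ((-2 * L t * Q t ^ 2) • (y + t • v) + Q t • v)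
  have hQ0 : Q 0 = q := by simp [Q, hq]
  have hL0 : L 0 = B := by simp [L]
  have hγ0 : γ 0 = inversion c R x := by
    rw [inversion_eq_smul_sub, ← hy, ← hq, ← hQ0]; simp [γ]
  have hγ'0 : γ' 0 = w := by simp [γ', hQ0, hL0, hw]
  have hline (t : ℝ) : HasDerivAt (fun t : ℝ => y + t • v) v t := by
    simpa using ((hasDerivAt_id t).smul_const v).const_add y
  have hne : ∀ᶠ t in 𝓝 (0 : ℝ), y + t • v ≠ 0 := by
    have := (hline 0).continuousAt.eventually_ne (y := (0 : E)) (by simpa using hy0)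
    simpa using this
  have hQ (t : ℝ) (ht : y + t • v ≠ 0) : HasDerivAt Q (-2 * L t * Q t ^ 2) t := by
    have h0 : ‖y + t • v‖ ^ 2 ≠ 0 := pow_ne_zero 2 (norm_ne_zero_iff.2 ht)
    have h1 := ((hline t).norm_sq).inv h0
    refine h1.congr_deriv ?_
    have : (⟪y + t • v, v⟫ : ℝ) = B + t := by
      rw [inner_add_left, inner_smul_left, real_inner_self_eq_norm_sq, hv]; simp [hB]
    rw [this]
    simp only [Q, L]
    field_simp
  have hL (t : ℝ) : HasDerivAt L 1 t := (hasDerivAt_id t).const_add B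
  have hγ (t : ℝ) (ht : y + t • v ≠ 0) : HasDerivAt γ (γ' t) t := by
    have h1 := (((hQ t ht).const_mul (R ^ 2)).smul (hline t)).const_add c
    refine h1.congr_deriv ?_
    simp only [γ']
    module
  have hpow (k : ℕ) (t : ℝ) (ht : y + t • v ≠ 0) :
      HasDerivAt (fun t => Q t ^ k) (-2 * k * L t * Q t ^ (k + 1)) t := by
    refine ((hQ t ht).pow k).congr_deriv ?_
    rcases k with _ | k
    · simp
    · simp only [Nat.add_sub_cancel]; ring
  have hγc : Tendsto γ (𝓝 0) (𝓝 (inversion c R x)) := by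
    rw [← hγ0]; exact (hγ 0 (by simpa using hy0)).continuousAt.tendsto
  have hdiff : ∀ᶠ z in 𝓝 (inversion c R x), DifferentiableAt ℝ u z := by
    filter_upwards [hu.eventually (by simp)] with z hz
    exact hz.differentiableAt (by norm_num)
  have hD2 : HasFDerivAt (fderiv ℝ u) (fderiv ℝ (fderiv ℝ u) (inversion c R x)) (γ 0) := by
    rw [hγ0]
    exact ((hu.fderiv_right (m := 1) (by norm_num)).differentiableAt (by norm_num)).hasFDerivAt
  have hD1 : HasFDerivAt u (fderiv ℝ u (inversion c R x)) (γ 0) := by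
    rw [hγ0]
    exact (hu.differentiableAt (by norm_num)).hasFDerivAt
  refine fderiv_fderiv_apply_eq_of_hasDerivAt_line (hu.kelvin hx)
    (d := fun t => -2 * m * L t * Q t ^ (m + 1) * u (γ t) + Q t ^ m * fderiv ℝ u (γ t) (γ' t))
    ?_ ?_
  · filter_upwards [hne, hγc.eventually hdiff] with t ht ht'
    have heq : (fun t => kelvin m c R u (x + t • v)) = fun t => Q t ^ m * u (γ t) := by
      funext t
      have : x + t • v - c = y + t • v := by rw [hy]; abel
      simp [kelvin, inversion_eq_smul_sub, this, γ, Q]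
    rw [heq]
    exact (hpow m t ht).mul (ht'.hasFDerivAt.comp_hasDerivAt t (hγ t ht))
  · have ht : y + (0 : ℝ) • v ≠ 0 := by simpa using hy0
    have hγ'' : HasDerivAt γ' (R ^ 2 • ((-2 * q ^ 2 + 8 * B ^ 2 * q ^ 3) • y
        - (4 * B * q ^ 2) • v)) 0 := by
      have h1 := ((((((hL 0).const_mul (-2)).mul (hpow 2 0 ht)).smul (hline 0)).add
        ((hQ 0 ht).smul_const v)).const_smul (R ^ 2))
      refine h1.congr_deriv ?_
      simp only [hQ0, hL0, Pi.mul_apply, zero_smul, add_zero]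
      push_cast
      module
    have h1 := ((((hL 0).const_mul (-2 * (m : ℝ))).mul (hpow (m + 1) 0 ht)).mul
      (hD1.comp_hasDerivAt (0 : ℝ) (hγ 0 ht))).add
      ((hpow m 0 ht).mul ((hD2.comp_hasDerivAt (0 : ℝ) (hγ 0 ht)).clm_apply hγ''))
    refine h1.congr_deriv ?_
    simp only [Pi.mul_apply, Function.comp_apply, hQ0, hL0, hγ0, hγ'0, map_smul, map_sub,
      smul_eq_mul]
    push_cast
    ring

variable [FiniteDimensional ℝ E]

theorem laplacian_eq_sum_fderiv_fderiv {ι : Type*} [Fintype ι] (b : OrthonormalBasis ι ℝ E)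
    (u : E → ℝ) (x : E) : Δ u x = ∑ i, fderiv ℝ (fderiv ℝ u) x (b i) (b i) := by
  rw [laplacian_eq_iteratedFDeriv_orthonormalBasis u b]
  simp [iteratedFDeriv_two_apply]

/-- The Laplacian of a Kelvin transform. -/
theorem laplacian_kelvin {m : ℕ} (hdim : Module.finrank ℝ E = 2 * m + 2) {c x : E} {R : ℝ}
    {u : E → ℝ} (hx : x ≠ c) (hu : ContDiffAt ℝ 2 u (inversion c R x)) :
    Δ (kelvin m c R u) x =
      R ^ 4 * ((‖x - c‖ ^ 2)⁻¹) ^ (m + 2) * Δ u (inversion c R x) := by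
  let b := stdOrthonormalBasis ℝ E
  rw [laplacian_eq_sum_fderiv_fderiv b, laplacian_eq_sum_fderiv_fderiv b]
  set q := (‖x - c‖ ^ 2)⁻¹ with hq
  rw [Finset.sum_congr rfl fun i _ => fderiv_fderiv_kelvin_apply hx hu (b.norm_eq_one i) hq rfl]
  set y := x - c with hy
  set D := fderiv ℝ u (inversion c R x)
  set D2 := fderiv ℝ (fderiv ℝ u) (inversion c R x)
  set U := u (inversion c R x)
  have hqA : q * ‖y‖ ^ 2 = 1 :=
    inv_mul_cancel₀ (pow_ne_zero 2 (norm_ne_zero_iff.2 (sub_ne_zero.2 hx)))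
  have hB2 : ∑ i, ⟪y, b i⟫ ^ 2 = ‖y‖ ^ 2 := by
    rw [← b.sum_sq_norm_inner_left y]; simp
  have hsum : ∑ i, (⟪y, b i⟫ : ℝ) • b i = y := by
    conv_rhs => rw [← b.sum_repr' y]
    simp only [real_inner_comm]
  have hl (l : E →L[ℝ] ℝ) : ∑ i, ⟪y, b i⟫ * l (b i) = l y := by
    conv_rhs => rw [← hsum]
    simp
  have h1 := hl D
  have h2 := hl (D2 y)
  have h3 := hl (D2.flip y)
  simp only [ContinuousLinearMap.flip_apply] at h3
  have hn : ∑ _i : Fin (Module.finrank ℝ E), (1 : ℝ) = 2 * m + 2 := by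
    simp [hdim]
  -- After summation over the basis, the terms in `U`, `D y` and `D2 y y` each cancel: `q * ‖y‖ ^ 2
  -- = 1`, and the dimension is exactly `2 * m + 2`.
  calc _ = ∑ i, ((-2 * m * q ^ (m + 1) * U - 2 * R ^ 2 * q ^ (m + 2) * D y) * 1
        + (4 * m * (m + 1) * q ^ (m + 2) * U + 8 * m * R ^ 2 * q ^ (m + 3) * D y
          + 4 * R ^ 4 * q ^ (m + 4) * D2 y y + 8 * R ^ 2 * q ^ (m + 3) * D y) * ⟪y, b i⟫ ^ 2
        + (-4 * m * R ^ 2 * q ^ (m + 2) - 4 * R ^ 2 * q ^ (m + 2)) * (⟪y, b i⟫ * D (b i))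
        + (-2 * R ^ 4 * q ^ (m + 3)) * (⟪y, b i⟫ * D2 y (b i))
        + (-2 * R ^ 4 * q ^ (m + 3)) * (⟪y, b i⟫ * D2 (b i) y)
        + R ^ 4 * q ^ (m + 2) * D2 (b i) (b i)) := by
        refine Finset.sum_congr rfl fun i _ => ?_
        simp only [map_smul, map_add, add_apply,
          smul_apply, smul_eq_mul]
        ring
    _ = _ := by
        simp only [Finset.sum_add_distrib, ← Finset.mul_sum]
        rw [hn, hB2, h1, h2, h3]
        linear_combination (4 * m * (m + 1) * q ^ (m + 1) * U + 8 * m * R ^ 2 * q ^ (m + 2) * D y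
          + 4 * R ^ 4 * q ^ (m + 3) * D2 y y + 8 * R ^ 2 * q ^ (m + 2) * D y) * hqA

/-- The Kelvin transform of a harmonic function is harmonic. -/
theorem InnerProductSpace.HarmonicAt.kelvin {m : ℕ} (hdim : Module.finrank ℝ E = 2 * m + 2)
    {c x : E} {R : ℝ} {u : E → ℝ} (hx : x ≠ c) (hu : HarmonicAt u (inversion c R x)) :
    HarmonicAt (kelvin m c R u) x := by
  refine ⟨hu.1.kelvin hx, ?_⟩
  have hc : ContinuousAt (fun x => inversion c R x) x :=
    continuousAt_const.inversion continuousAt_const continuousAt_id hx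
  filter_upwards [hc.tendsto.eventually hu.eventually, eventually_ne_nhds hx] with z hz hzc
  rw [laplacian_kelvin hdim hzc hz.1, hz.2.self_of_nhds]
  simp

end Kelvin

/-! ### The mean value property with radial weights. -/

section MeanValue

open InnerProductSpace Filter Topology MeasureTheory Metric
open scoped RealInnerProductSpace Laplacian

variable {E : Type*} [NormedAddCommGroup E] [InnerProductSpace ℝ E] [FiniteDimensional ℝ E]

theorem InnerProductSpace.HarmonicAt.contDiffAt_fderiv {u : E → ℝ} {x : E} (hu : HarmonicAt u x) :
    ContDiffAt ℝ 1 (fderiv ℝ u) x :=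
  hu.1.fderiv_right (by norm_num)

theorem InnerProductSpace.HarmonicAt.continuousAt_fderiv_fderiv {u : E → ℝ} {x : E}
    (hu : HarmonicAt u x) : ContinuousAt (fderiv ℝ (fderiv ℝ u)) x :=
  (hu.contDiffAt_fderiv.fderiv_right (m := 0) (by norm_num)).continuousAt

variable [MeasurableSpace E] [BorelSpace E] (μ : Measure E) [μ.IsAddHaarMeasure]

theorem integrable_mul_of_continuousOn_closedBall {p k : E → ℝ} {R : ℝ} (hp : Continuous p)
    (hp0 : ∀ z, R ≤ ‖z‖ → p z = 0) (hk : ContinuousOn k (closedBall 0 R)) :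
    Integrable (fun z => p z * k z) μ := by
  have h : IntegrableOn (fun z => p z * k z) (closedBall 0 R) μ :=
    (hp.continuousOn.mul hk).integrableOn_compact (isCompact_closedBall 0 R)
  refine (integrableOn_iff_integrable_of_support_subset fun z hz => ?_).1 h
  rw [mem_closedBall_zero_iff]
  by_contra! hR
  exact hz (by simp [hp0 z hR.le])

/-- The radial derivative of a harmonic function has vanishing mean for every radial weight. -/
theorem integral_radial_mul_fderiv_eq_zero {u : E → ℝ} {x : E} {t R : ℝ} (hR : 0 ≤ R)
    (hu : ∀ z ∈ closedBall (0 : E) R, HarmonicAt u (x + t • z)) {η : ℝ → ℝ} (hη : Continuous η)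
    (hη0 : ∀ s, R ^ 2 ≤ s → η s = 0) :
    ∫ z, η (‖z‖ ^ 2) * fderiv ℝ u (x + t • z) z ∂μ = 0 := by
  let b := stdOrthonormalBasis ℝ E
  -- The base point `R ^ 2` makes this primitive of `η` vanish outside the ball, so integration by
  -- parts has no boundary term. The gradient of `H (‖z‖ ^ 2)` is `2 η (‖z‖ ^ 2) z`, hence the
  -- weighted radial derivative integrates to a multiple of `∫ H Δu = 0`.
  let H : ℝ → ℝ := fun s => ∫ r in (R ^ 2)..s, η r
  have hH (s : ℝ) : HasDerivAt H (η s) s := (hη.integral_hasStrictDerivAt _ s).hasDerivAt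
  have hHc : Continuous H := continuous_iff_continuousAt.2 fun s => (hH s).continuousAt
  have hH0 (s : ℝ) (hs : R ^ 2 ≤ s) : H s = 0 := by
    refine intervalIntegral.integral_zero_ae (ae_of_all _ fun r hr => hη0 r ?_)
    rw [Set.uIoc_of_le hs] at hr
    exact hr.1.le
  have hsq {z : E} (hz : R ≤ ‖z‖) : R ^ 2 ≤ ‖z‖ ^ 2 := by gcongr
  have haff : Continuous fun z : E => x + t • z := by fun_prop
  have hc1 : ContinuousOn (fun z => fderiv ℝ u (x + t • z)) (closedBall 0 R) := fun z hz =>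
    (ContinuousAt.comp (f := fun z => x + t • z) (hu z hz).contDiffAt_fderiv.continuousAt
      haff.continuousAt).continuousWithinAt
  have hc2 : ContinuousOn (fun z => fderiv ℝ (fderiv ℝ u) (x + t • z)) (closedBall 0 R) :=
    fun z hz => (ContinuousAt.comp (f := fun z => x + t • z) (hu z hz).continuousAt_fderiv_fderiv
      haff.continuousAt).continuousWithinAt
  have hp2 : Continuous fun z : E => H (‖z‖ ^ 2) := by fun_prop
  have hI1 (i) : Integrable (fun z => 2 * ⟪z, b i⟫ * η (‖z‖ ^ 2) * fderiv ℝ u (x + t • z) (b i))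
      μ := by
    refine integrable_mul_of_continuousOn_closedBall μ (by fun_prop) (fun z hz => ?_)
      (hc1.clm_apply continuousOn_const)
    simp [hη0 _ (hsq hz)]
  have hI2 (i) : Integrable
      (fun z => H (‖z‖ ^ 2) * (t * fderiv ℝ (fderiv ℝ u) (x + t • z) (b i) (b i))) μ := by
    refine integrable_mul_of_continuousOn_closedBall μ hp2 (fun z hz => hH0 _ (hsq hz)) ?_
    exact continuousOn_const.mul ((hc2.clm_apply continuousOn_const).clm_apply continuousOn_const)
  have hI3 (i) : Integrable (fun z => H (‖z‖ ^ 2) * fderiv ℝ u (x + t • z) (b i)) μ :=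
    integrable_mul_of_continuousOn_closedBall μ hp2 (fun z hz => hH0 _ (hsq hz))
      (hc1.clm_apply continuousOn_const)
  have hline (z v : E) : HasDerivAt (fun r : ℝ => z + r • v) v 0 := by
    simpa using ((hasDerivAt_id (0 : ℝ)).smul_const v).const_add z
  have hparts (i) : ∫ z, H (‖z‖ ^ 2) * (t * fderiv ℝ (fderiv ℝ u) (x + t • z) (b i) (b i)) ∂μ =
      - ∫ z, 2 * ⟪z, b i⟫ * η (‖z‖ ^ 2) * fderiv ℝ u (x + t • z) (b i) ∂μ := by
    refine integral_bilinear_hasLineDerivAt_right_eq_neg_left_of_integrable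
      (B := ContinuousLinearMap.mul ℝ ℝ) (v := b i) (f := fun z => H (‖z‖ ^ 2))
      (f' := fun z => 2 * ⟪z, b i⟫ * η (‖z‖ ^ 2))
      (g := fun z => fderiv ℝ u (x + t • z) (b i))
      (g' := fun z => t * fderiv ℝ (fderiv ℝ u) (x + t • z) (b i) (b i))
      (hI1 i) (hI2 i) (hI3 i) (fun z _ => ?_) (fun z hz => ?_)
    · have h1 := (hline z (b i)).norm_sq
      have h2 : HasDerivAt H (η (‖z‖ ^ 2)) (‖z + (0 : ℝ) • b i‖ ^ 2) := by simpa using hH (‖z‖ ^ 2)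
      refine (h2.comp (0 : ℝ) h1).congr_deriv ?_
      simp only [zero_smul, add_zero]
      ring
    · have hz' : z ∈ closedBall (0 : E) R := by
        refine closure_minimal (fun z hz => ?_) isClosed_closedBall hz
        rw [mem_closedBall_zero_iff]
        by_contra! hR
        exact hz (hH0 _ (hsq hR.le))
      have h1 : HasDerivAt (fun r : ℝ => x + t • (z + r • b i)) (t • b i) 0 :=
        ((hline z (b i)).const_smul t).const_add x
      have h2 : HasFDerivAt (fderiv ℝ u) (fderiv ℝ (fderiv ℝ u) (x + t • z))
          (x + t • (z + (0 : ℝ) • b i)) := by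
        simpa using ((hu z hz').contDiffAt_fderiv.differentiableAt (by norm_num)).hasFDerivAt
      have h3 : HasDerivAt (fun r : ℝ => fderiv ℝ u (x + t • (z + r • b i)))
          (fderiv ℝ (fderiv ℝ u) (x + t • z) (t • b i)) 0 := h2.comp_hasDerivAt (0 : ℝ) h1
      refine ((ContinuousLinearMap.apply ℝ ℝ (b i)).hasFDerivAt.comp_hasDerivAt
        (0 : ℝ) h3).congr_deriv ?_
      simp
  have hsum : ∑ i, ∫ z, 2 * ⟪z, b i⟫ * η (‖z‖ ^ 2) * fderiv ℝ u (x + t • z) (b i) ∂μ = 0 := by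
    rw [← neg_eq_zero, ← Finset.sum_neg_distrib, ← Finset.sum_congr rfl fun i _ => hparts i,
      ← integral_finsetSum _ fun i _ => hI2 i]
    refine integral_eq_zero_of_ae (ae_of_all _ fun z => ?_)
    rcases le_or_gt R ‖z‖ with hz | hz
    · simp [hH0 _ (hsq hz)]
    · have h0 : Δ u (x + t • z) = 0 := (hu z (mem_closedBall_zero_iff.2 hz.le)).2.self_of_nhds
      rw [laplacian_eq_sum_fderiv_fderiv b] at h0
      simp [← Finset.mul_sum, h0]
  rw [← integral_finsetSum _ fun i _ => hI1 i] at hsum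
  have heq (z : E) : ∑ i, 2 * ⟪z, b i⟫ * η (‖z‖ ^ 2) * fderiv ℝ u (x + t • z) (b i) =
      2 * (η (‖z‖ ^ 2) * fderiv ℝ u (x + t • z) z) := by
    have hz : fderiv ℝ u (x + t • z) z = ∑ i, ⟪z, b i⟫ * fderiv ℝ u (x + t • z) (b i) := by
      conv_lhs => enter [2]; rw [← b.sum_repr' z]
      simp only [map_sum, map_smul, smul_eq_mul, real_inner_comm]
    rw [hz, Finset.mul_sum, Finset.mul_sum]
    exact Finset.sum_congr rfl fun i _ => by ring
  simp only [heq, integral_const_mul] at hsum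
  linarith

/-- The weighted mean of `u (x + t • z)` has zero derivative in `t`, by
`integral_radial_mul_fderiv_eq_zero`; compare `t = 1` with `t = 0`. -/
theorem integral_radial_mul_eq_of_harmonicOnNhd {u : E → ℝ} {x : E} {R R' : ℝ} (hR : 0 < R)
    (hRR' : R < R') (hu : HarmonicOnNhd u (ball x R')) {η : ℝ → ℝ} (hη : Continuous η)
    (hη0 : ∀ s, R ^ 2 ≤ s → η s = 0) :
    ∫ z, η (‖z‖ ^ 2) * u (x + z) ∂μ = (∫ z, η (‖z‖ ^ 2) ∂μ) * u x := by
  -- Room beyond `t = 1` allows differentiation under the integral on an open interval containing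
  -- `[0, 1]`.
  obtain ⟨b, hb1, hbR⟩ : ∃ b : ℝ, 1 < b ∧ b * R < R' := by
    obtain ⟨b, hb1, hb⟩ := exists_between ((one_lt_div hR).2 hRR')
    exact ⟨b, hb1, (lt_div_iff₀ hR).1 hb⟩
  have hsq {z : E} (hz : R ≤ ‖z‖) : R ^ 2 ≤ ‖z‖ ^ 2 := by gcongr
  have hmem {t : ℝ} (ht : |t| ≤ b) {z : E} (hz : ‖z‖ ≤ R) : x + t • z ∈ closedBall x (b * R) := by
    rw [mem_closedBall_iff_norm, add_sub_cancel_left, norm_smul, Real.norm_eq_abs]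
    gcongr
  have hsub : closedBall x (b * R) ⊆ ball x R' := closedBall_subset_ball hbR
  have hp : Continuous fun z : E => η (‖z‖ ^ 2) := by fun_prop
  have hcont (t : ℝ) (ht : |t| ≤ b) : ContinuousOn (fun z => u (x + t • z)) (closedBall 0 R) := by
    refine hu.continuousOn.comp (by fun_prop) fun z hz => hsub (hmem ht ?_)
    simpa using hz
  have hDc : ContinuousOn (fderiv ℝ u) (closedBall x (b * R)) := fun z hz =>
    (hu z (hsub hz)).contDiffAt_fderiv.continuousAt.continuousWithinAt
  obtain ⟨C, hC⟩ := (isCompact_closedBall x (b * R)).exists_bound_of_continuousOn hDc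
  have hint (t : ℝ) (ht : |t| ≤ b) : Integrable (fun z => η (‖z‖ ^ 2) * u (x + t • z)) μ :=
    integrable_mul_of_continuousOn_closedBall μ hp (fun z hz => hη0 _ (hsq hz)) (hcont t ht)
  have hderiv (t : ℝ) (ht : |t| < b) :
      HasDerivAt (fun t => ∫ z, η (‖z‖ ^ 2) * u (x + t • z) ∂μ) 0 t := by
    have hs : Set.Ioo (-b) b ∈ 𝓝 t := Ioo_mem_nhds (abs_lt.1 ht).1 (abs_lt.1 ht).2
    have hI : Integrable (fun z => η (‖z‖ ^ 2) * fderiv ℝ u (x + t • z) z) μ := by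
      refine integrable_mul_of_continuousOn_closedBall μ hp (fun z hz => hη0 _ (hsq hz)) ?_
      refine ContinuousOn.clm_apply (hDc.comp (by fun_prop) fun z hz => hmem ht.le ?_)
        continuousOn_id
      simpa using hz
    have key := hasDerivAt_integral_of_dominated_loc_of_deriv_le (μ := μ) (𝕜 := ℝ)
      (F := fun t z => η (‖z‖ ^ 2) * u (x + t • z))
      (F' := fun t z => η (‖z‖ ^ 2) * fderiv ℝ u (x + t • z) z)
      (bound := fun z => |η (‖z‖ ^ 2)| * (C * ‖z‖)) hs ?_ (hint t ht.le) hI.aestronglyMeasurable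
      ?_ ?_ ?_
    · refine key.2.congr_deriv ?_
      refine integral_radial_mul_fderiv_eq_zero μ hR.le (fun z hz => hu _ (hsub (hmem ht.le ?_)))
        hη hη0
      simpa using hz
    · filter_upwards [hs] with r hr
      exact (hint r (abs_lt.2 hr).le).aestronglyMeasurable
    · refine ae_of_all _ fun z r hr => ?_
      rcases le_or_gt R ‖z‖ with hz | hz
      · simp [hη0 _ (hsq hz)]
      · rw [norm_mul, Real.norm_eq_abs]
        gcongr
        exact (fderiv ℝ u (x + r • z)).le_of_opNorm_le (hC _ (hmem (abs_lt.2 hr).le hz.le)) z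
    · exact integrable_mul_of_continuousOn_closedBall μ (R := R) hp.abs
        (fun z hz => by simp [hη0 _ (hsq hz)]) (by fun_prop)
    · refine ae_of_all _ fun z r hr => ?_
      rcases le_or_gt R ‖z‖ with hz | hz
      · simpa [hη0 _ (hsq hz)] using hasDerivAt_const r (0 : ℝ)
      · have h1 : HasDerivAt (fun r : ℝ => x + r • z) z r := by
          simpa using ((hasDerivAt_id r).smul_const z).const_add x
        have h2 := ((hu _ (hsub (hmem (abs_lt.2 hr).le hz.le))).1.differentiableAt
          (by norm_num)).hasFDerivAt
        exact (h2.comp_hasDerivAt r h1).const_mul _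
  have hlt {t : ℝ} (ht : t ∈ Set.Icc (0 : ℝ) 1) : |t| < b := by
    rw [abs_of_nonneg ht.1]; exact ht.2.trans_lt hb1
  have := constant_of_has_deriv_right_zero (a := (0 : ℝ)) (b := 1)
    (fun t ht => (hderiv t (hlt ht)).continuousAt.continuousWithinAt)
    (fun t ht => (hderiv t (hlt (Set.Ico_subset_Icc_self ht))).hasDerivWithinAt)
    1 (Set.right_mem_Icc.2 zero_le_one)
  simpa [integral_mul_const] using this

/-- The **mean value property** of harmonic functions, for continuous radial weights. -/
theorem integral_norm_mul_eq_of_harmonicOnNhd {u : E → ℝ} {x : E} {R R' : ℝ} (hR : 0 < R)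
    (hRR' : R < R') (hu : HarmonicOnNhd u (ball x R')) {p : ℝ → ℝ} (hp : Continuous p)
    (hp0 : ∀ s, R ≤ s → p s = 0) :
    ∫ z, p ‖z‖ * u (x + z) ∂μ = (∫ z, p ‖z‖ ∂μ) * u x := by
  have := integral_radial_mul_eq_of_harmonicOnNhd μ hR hRR' hu (η := fun s => p √s)
    (by fun_prop) (fun s hs => hp0 _ (Real.le_sqrt_of_sq_le hs))
  simpa using this

/-- Scaling a cone by `c` contributes `c` for each dimension of the base and one more for the
height. -/
theorem integral_max_sub_norm_smul {R c : ℝ} (hc : 0 < c) :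
    ∫ z, max 0 (c * R - ‖z‖) ∂μ =
      c ^ (Module.finrank ℝ E + 1) * ∫ z, max 0 (R - ‖z‖) ∂μ := by
  have h := Measure.integral_comp_smul μ (fun z : E => max 0 (c * R - ‖z‖)) c
  have heq (z : E) : max 0 (c * R - ‖c • z‖) = c * max 0 (R - ‖z‖) := by
    rw [mul_max_of_nonneg _ _ hc.le, norm_smul, Real.norm_of_nonneg hc.le]
    ring_nf
  simp only [heq, integral_const_mul, smul_eq_mul] at h
  rw [abs_of_pos (by positivity)] at h
  rw [pow_succ, mul_assoc, h, ← mul_assoc, mul_inv_cancel₀ (by positivity), one_mul]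

end MeanValue

/-! ### Harnack's inequality and the Schwarz lemma at the origin. -/

section Harnack

open InnerProductSpace MeasureTheory Metric

variable {E : Type*} [NormedAddCommGroup E] [InnerProductSpace ℝ E] [FiniteDimensional ℝ E]

/-- A **Harnack inequality** for nonnegative harmonic functions on the unit ball. -/
theorem pow_mul_le_of_harmonicOnNhd {u : E → ℝ} (hu : HarmonicOnNhd u (ball 0 1))
    (hu0 : ∀ z ∈ ball (0 : E) 1, 0 ≤ u z) {x : E} {R : ℝ} (hxR : ‖x‖ < R) (hR : R + ‖x‖ < 1) :
    (1 - ‖x‖ / R) ^ (Module.finrank ℝ E + 1) * u 0 ≤ u x := by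
  borelize E
  let μ : Measure E := Measure.addHaar
  have hR0 : 0 < R := (norm_nonneg x).trans_lt hxR
  have hxb : ball x (1 - ‖x‖) ⊆ ball 0 1 := by
    refine ball_subset_ball' ?_
    simp
  have hc : 0 < 1 - ‖x‖ / R := by rw [sub_pos, div_lt_one hR0]; exact hxR
  have h1 := integral_norm_mul_eq_of_harmonicOnNhd μ hR0 (lt_sub_iff_add_lt.2 hR)
    (hu.mono hxb) (p := fun s => max 0 (R - s)) (by fun_prop) (fun s hs => by simpa using hs)
  have h2 := integral_norm_mul_eq_of_harmonicOnNhd μ (R := R - ‖x‖) (by linarith)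
    (show R - ‖x‖ < 1 by linarith [norm_nonneg x]) hu
    (p := fun s => max 0 (R - ‖x‖ - s)) (by fun_prop) (fun s hs => by simpa using hs)
  have h3 : R - ‖x‖ = (1 - ‖x‖ / R) * R := by field_simp
  have hpos : 0 < ∫ z, max 0 (R - ‖z‖) ∂μ := by
    refine Continuous.integral_pos_of_hasCompactSupport_nonneg_nonzero (x := 0) (by fun_prop)
      ?_ (fun z => le_max_left _ _) (by simpa using hR0)
    refine HasCompactSupport.intro (isCompact_closedBall (0 : E) R) fun z hz => ?_
    simp only [mem_closedBall_zero_iff, not_le] at hz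
    simpa using hz.le
  have hI2 : Integrable (fun z => max 0 (R - ‖x‖ - ‖z‖) * u z) μ := by
    refine integrable_mul_of_continuousOn_closedBall μ (R := R - ‖x‖) (by fun_prop)
      (fun s hs => by simpa using hs)
      (hu.continuousOn.mono (closedBall_subset_ball ?_))
    linarith [norm_nonneg x]
  have hI1 : Integrable (fun z => max 0 (R - ‖z‖) * u (x + z)) μ := by
    refine integrable_mul_of_continuousOn_closedBall μ (R := R) (by fun_prop)
      (fun s hs => by simpa using hs) (hu.continuousOn.comp (by fun_prop) fun z hz => ?_)
    rw [mem_closedBall_zero_iff] at hz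
    rw [mem_ball_zero_iff]
    linarith [norm_add_le x z]
  -- The cone of radius `R - ‖x‖` about `0` lies below the cone of radius `R` about `x`, by the
  -- triangle inequality. As `u ≥ 0`, their weighted integrals compare; the mean value property
  -- evaluates both.
  have h4 := integral_mono (hI2.comp_add_left x) hI1 fun z => ?_
  · rw [integral_add_left_eq_self (fun z => max 0 (R - ‖x‖ - ‖z‖) * u z) x, h1] at h4
    simp only [zero_add] at h2
    rw [h2, h3, integral_max_sub_norm_smul μ hc] at h4
    refine le_of_mul_le_mul_left ?_ hpos
    linarith
  · rcases le_or_gt R ‖z‖ with hz | hz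
    · have : R - ‖x‖ - ‖x + z‖ ≤ 0 := by
        have := norm_sub_le (x + z) x
        rw [add_sub_cancel_left] at this
        linarith
      simp [hz, this]
    · have hxz : x + z ∈ ball (0 : E) 1 := by
        rw [mem_ball_zero_iff]
        linarith [norm_add_le x z]
      refine mul_le_mul_of_nonneg_right (max_le_max le_rfl ?_) (hu0 _ hxz)
      have := norm_sub_le (x + z) x
      rw [add_sub_cancel_left] at this
      linarith

/-- A **Schwarz lemma** for harmonic functions on the unit ball of `ℝ⁸`. -/
theorem abs_le_of_harmonicOnNhd_of_apply_zero (hdim : Module.finrank ℝ E = 8) {u : E → ℝ}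
    (hu : HarmonicOnNhd u (ball 0 1)) {M : ℝ} (hM : ∀ z ∈ ball (0 : E) 1, |u z| ≤ M)
    (h0 : u 0 = 0) {x : E} (hx : x ∈ ball (0 : E) 1) : |u x| ≤ 10 * M * ‖x‖ := by
  have hM0 : 0 ≤ M := (abs_nonneg _).trans (hM x hx)
  -- For `‖x‖ ≥ 1 / 10` the bound `M` is already enough.
  rcases le_or_gt (1 / 10) ‖x‖ with hr | hr
  · have := hM x hx
    nlinarith
  have key (v : E → ℝ) (hv : HarmonicOnNhd v (ball 0 1)) (hvM : ∀ z ∈ ball (0 : E) 1, |v z| ≤ M)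
      (hv0 : v 0 = 0) : -(10 * M * ‖x‖) ≤ v x := by
    have h1 : HarmonicOnNhd ((fun _ => M) + v) (ball 0 1) :=
      (harmonicOnNhd_const M).add hv
    -- The exponent is `8 + 1 = 9`, so with `R = 9 / 10` Bernoulli's inequality gives `(1 -
    -- 10‖x‖/9)⁹ ≥ 1 - 10‖x‖`.
    have h2 := pow_mul_le_of_harmonicOnNhd h1
      (fun z hz => by simpa using! neg_le_iff_add_nonneg'.1 (neg_le_of_abs_le (hvM z hz)))
      (x := x) (R := 9 / 10) (by linarith) (by linarith)
    simp only [Pi.add_apply, hv0, add_zero, hdim] at h2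
    have h3 := one_add_mul_le_pow (a := -(‖x‖ / (9 / 10))) (by linarith) 9
    rw [← sub_eq_add_neg] at h3
    have h4 := mul_le_mul_of_nonneg_right h3 hM0
    push_cast at h4
    norm_num at h2
    linarith
  have h1 := key u hu hM h0
  have h2 := key (-u) hu.neg (fun z hz => by simpa using hM z hz) (by simpa using h0)
  rw [Pi.neg_apply] at h2
  exact abs_le.2 ⟨h1, by linarith⟩

end Harnack

/-! ### Moving the zero to the origin by an inversion of the ball. -/

section SchwarzPick

open InnerProductSpace Metric EuclideanGeometry
open scoped RealInnerProductSpace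

variable {E : Type*} [NormedAddCommGroup E] [InnerProductSpace ℝ E]

/-- Identifies `‖a‖ * ‖y - c‖`, with `c` the inversion center, as the quantity that becomes `|1 -
āy|` for octonions. -/
theorem norm_sq_mul_norm_sub_sq_eq {a : E} (ha : a ≠ 0) (y : E) :
    ‖a‖ ^ 2 * ‖y - (‖a‖ ^ 2)⁻¹ • a‖ ^ 2 = ‖y - a‖ ^ 2 + (1 - ‖a‖ ^ 2) * (1 - ‖y‖ ^ 2) := by
  have hA : ‖a‖ ≠ 0 := norm_ne_zero_iff.2 ha
  rw [norm_sub_sq_real, norm_sub_sq_real, norm_smul, inner_smul_right, norm_inv, norm_pow,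
    norm_norm]
  field_simp
  ring

/-- The condition on `R` reads `R² = |c|² - 1`: the sphere of inversion is orthogonal to the unit
sphere. -/
theorem inversion_zero_eq {a : E} (ha : a ≠ 0) {R : ℝ} (hR : R ^ 2 = (‖a‖ ^ 2)⁻¹ - 1) :
    inversion ((‖a‖ ^ 2)⁻¹ • a) R 0 = a := by
  have hA : ‖a‖ ≠ 0 := norm_ne_zero_iff.2 ha
  rw [inversion_eq_smul_sub, zero_sub, norm_neg, norm_smul, norm_inv, norm_pow, norm_norm, hR,
    smul_neg, smul_smul, ← sub_eq_add_neg, ← sub_smul]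
  convert one_smul ℝ a using 2
  field_simp
  ring

theorem norm_inversion_eq_div {a : E} (ha : a ≠ 0) {R : ℝ} (hR0 : R ≠ 0)
    (hR : R ^ 2 = (‖a‖ ^ 2)⁻¹ - 1) {y : E} (hy : y ≠ (‖a‖ ^ 2)⁻¹ • a) :
    ‖inversion ((‖a‖ ^ 2)⁻¹ • a) R y‖ = ‖y - a‖ / (‖a‖ * ‖y - (‖a‖ ^ 2)⁻¹ • a‖) := by
  have hA : ‖a‖ ≠ 0 := norm_ne_zero_iff.2 ha
  set c := (‖a‖ ^ 2)⁻¹ • a with hc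
  have h0 : inversion c R 0 = a := inversion_zero_eq ha hR
  have hc0 : (0 : E) ≠ c := (smul_ne_zero (inv_ne_zero (pow_ne_zero 2 hA)) ha).symm
  have hac : a ≠ c := by rw [← h0, Ne, inversion_eq_center hR0]; exact hc0
  have h1 : inversion c R a = 0 := by rw [← h0, inversion_inversion c hR0]
  have h2 : dist a c = R ^ 2 * ‖a‖ := by
    rw [← h0, dist_inversion_center, h0, dist_zero_left, hc, norm_smul, norm_inv, norm_pow,
      norm_norm]
    field_simp
  rw [← dist_zero_right, ← h1, dist_inversion_inversion hy hac, h2, dist_eq_norm, dist_eq_norm]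
  field_simp

variable [FiniteDimensional ℝ E]

/-- A **Schwarz–Pick lemma** for harmonic functions on the unit ball of `ℝ⁸`. -/
theorem abs_le_of_harmonicOnNhd_of_apply_eq_zero (hdim : Module.finrank ℝ E = 8) {u : E → ℝ}
    (hu : HarmonicOnNhd u (ball 0 1)) (hu1 : ∀ z ∈ ball (0 : E) 1, |u z| ≤ 1) {a : E}
    (ha : a ∈ ball (0 : E) 1) (hua : u a = 0) {y : E} (hy : y ∈ ball (0 : E) 1) {N : ℝ}
    (hN0 : 0 ≤ N) (hN : N ^ 2 = ‖y - a‖ ^ 2 + (1 - ‖a‖ ^ 2) * (1 - ‖y‖ ^ 2)) :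
    |u y| ≤ 10 * (1 + ‖a‖) ^ 6 * (‖y - a‖ / N ^ 7) := by
  -- For `a = 0` the inversion center would lie at infinity, and the Schwarz lemma applies directly.
  rcases eq_or_ne a 0 with rfl | ha0
  · have hN1 : N = 1 := by
      rw [← sq_eq_sq₀ hN0 zero_le_one, hN]; simp
    have := abs_le_of_harmonicOnNhd_of_apply_zero hdim hu hu1 hua hy
    simpa [hN1] using this
  rw [mem_ball_zero_iff] at ha
  have hA : 0 < ‖a‖ := norm_pos_iff.2 ha0
  have hA2 : ‖a‖ ^ 2 < 1 := pow_lt_one₀ hA.le ha two_ne_zero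
  set c := (‖a‖ ^ 2)⁻¹ • a with hc
  have hRpos : 0 < (‖a‖ ^ 2)⁻¹ - 1 := by
    rw [sub_pos]; exact (one_lt_inv₀ (by positivity)).2 hA2
  obtain ⟨R, hR0, hR⟩ : ∃ R : ℝ, R ≠ 0 ∧ R ^ 2 = (‖a‖ ^ 2)⁻¹ - 1 :=
    ⟨√((‖a‖ ^ 2)⁻¹ - 1), (Real.sqrt_pos.2 hRpos).ne', Real.sq_sqrt hRpos.le⟩
  have hcn : ‖c‖ = ‖a‖⁻¹ := by
    rw [hc, norm_smul, norm_inv, norm_pow, norm_norm]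
    field_simp
  have hdist {z : E} (hz : z ∈ ball (0 : E) 1) : ‖a‖⁻¹ - 1 < ‖z - c‖ := by
    rw [mem_ball_zero_iff] at hz
    have := norm_sub_norm_le c z
    rw [hcn, norm_sub_rev] at this
    linarith
  have hA1 : 0 < ‖a‖⁻¹ - 1 := by rw [sub_pos]; exact (one_lt_inv₀ hA).2 ha
  have hne {z : E} (hz : z ∈ ball (0 : E) 1) : z ≠ c := by
    rintro rfl
    simpa using (hA1.trans (hdist hz))
  have hmaps {z : E} (hz : z ∈ ball (0 : E) 1) : inversion c R z ∈ ball (0 : E) 1 := by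
    have h1 : 0 < ‖z - c‖ := hA1.trans (hdist hz)
    rw [mem_ball_zero_iff, norm_inversion_eq_div ha0 hR0 hR (hne hz), div_lt_one (by positivity),
      ← sq_lt_sq₀ (norm_nonneg _) (by positivity), mul_pow, norm_sq_mul_norm_sub_sq_eq ha0]
    rw [mem_ball_zero_iff] at hz
    have hz2 : ‖z‖ ^ 2 < 1 := pow_lt_one₀ (norm_nonneg z) hz two_ne_zero
    nlinarith
  have hg : HarmonicOnNhd (kelvin 3 c R u) (ball 0 1) := fun z hz =>
    HarmonicAt.kelvin (by simpa using hdim) (hne hz) (hu _ (hmaps hz))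
  have hgM (z : E) (hz : z ∈ ball (0 : E) 1) :
      |kelvin 3 c R u z| ≤ (((‖a‖⁻¹ - 1) ^ 2)⁻¹) ^ 3 := by
    rw [kelvin, abs_mul, abs_of_nonneg (by positivity)]
    have h1 : ((‖z - c‖ ^ 2)⁻¹) ^ 3 ≤ (((‖a‖⁻¹ - 1) ^ 2)⁻¹) ^ 3 := by
      have := (hdist hz).le
      gcongr
    exact (mul_le_of_le_one_right (by positivity) (hu1 _ (hmaps hz))).trans h1
  have hg0 : kelvin 3 c R u 0 = 0 := by
    rw [kelvin, inversion_zero_eq ha0 hR, hua, mul_zero]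
  have hd : ‖a‖ * ‖y - c‖ = N := by
    rw [← sq_eq_sq₀ (by positivity) hN0, mul_pow, norm_sq_mul_norm_sub_sq_eq ha0, hN]
  have hd0 : 0 < ‖y - c‖ := hA1.trans (hdist hy)
  have hNpos : 0 < N := hd ▸ mul_pos hA hd0
  -- Evaluated at the inverse point of `y`, the Kelvin transform returns a multiple of `u y`. The
  -- weight and the bound combine to `((1 - |a|²) / (1 - |a|))⁶ = (1 + |a|)⁶`.
  have key := abs_le_of_harmonicOnNhd_of_apply_zero hdim hg hgM hg0 (hmaps hy)
  have hdc : ‖inversion c R y - c‖ = ((‖a‖ ^ 2)⁻¹ - 1) / (N / ‖a‖) := by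
    rw [← dist_eq_norm, dist_inversion_center, hR, dist_eq_norm, ← hd,
      mul_div_cancel_left₀ _ hA.ne']
  rw [kelvin, inversion_inversion c hR0, hdc, norm_inversion_eq_div ha0 hR0 hR (hne hy), ← hc, hd,
    abs_mul, abs_of_nonneg (by positivity)] at key
  have hpos : 0 < (((((‖a‖ ^ 2)⁻¹ - 1) / (N / ‖a‖)) ^ 2)⁻¹) ^ 3 := by positivity
  refine le_of_mul_le_mul_left (key.trans_eq ?_) hpos
  have h1 : ‖a‖⁻¹ - 1 = (1 - ‖a‖) / ‖a‖ := by field_simp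
  have h2 : (‖a‖ ^ 2)⁻¹ - 1 = (1 - ‖a‖) * (1 + ‖a‖) / ‖a‖ ^ 2 := by field_simp; ring
  have h3 : 1 - ‖a‖ ≠ 0 := (sub_pos.2 ha).ne'
  rw [h1, h2]
  field_simp

end SchwarzPick

/-! ### The octonion norm identity and the reduction to real functions. -/

namespace Octonion

theorem norm_sq_eq (x : Octonion) : ‖x‖ ^ 2 = ‖x.fst‖ ^ 2 + ‖x.snd‖ ^ 2 :=
  WithLp.prod_norm_sq_eq_of_L2 (α := ℍ[ℝ]) (β := ℍ[ℝ]) x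

theorem finrank_eq : Module.finrank ℝ Octonion = 8 := by
  have h : Module.finrank ℝ Octonion = Module.finrank ℝ (ℍ[ℝ] × ℍ[ℝ]) :=
    (WithLp.linearEquiv 2 ℝ (ℍ[ℝ] × ℍ[ℝ])).finrank_eq
  rw [h, Module.finrank_prod, Quaternion.finrank_eq_four]

/-- Both sides equal `1 - 2⟪a, x⟫ + |a|²|x|²`, since the norm is multiplicative and `Re(āx) = ⟪a,
x⟫`; here this is checked in coordinates. -/
theorem norm_one_sub_star_mul_sq (a x : Octonion) :
    ‖1 - star a * x‖ ^ 2 = ‖x - a‖ ^ 2 + (1 - ‖a‖ ^ 2) * (1 - ‖x‖ ^ 2) := by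
  have h1 : (1 - star a * x).fst = 1 - (star a.fst * x.fst - star x.snd * -a.snd) := rfl
  have h2 : (1 - star a * x).snd = 0 - (x.snd * star a.fst + -a.snd * star x.fst) := rfl
  have h3 : (x - a).fst = x.fst - a.fst := rfl
  have h4 : (x - a).snd = x.snd - a.snd := rfl
  simp only [norm_sq_eq, h1, h2, h3, h4]
  simp only [sq, ← Quaternion.normSq_eq_norm_mul_self, Quaternion.normSq_def']
  simp
  ring

end Octonion

/-- It amounts to `2 ≤ 1.1⁸`. -/
theorem ten_le_inv_two_rpow_sub_one :
    0 < (2 : ℝ) ^ (1 / 8 : ℝ) - 1 ∧ 10 ≤ ((2 : ℝ) ^ (1 / 8 : ℝ) - 1)⁻¹ := by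
  have h1 : (1 : ℝ) < 2 ^ (1 / 8 : ℝ) := Real.one_lt_rpow (by norm_num) (by norm_num)
  have h2 : (2 : ℝ) ^ (1 / 8 : ℝ) ≤ 11 / 10 := by
    refine le_of_pow_le_pow_left₀ (n := 8) (by norm_num) (by norm_num) ?_
    rw [← Real.rpow_natCast, ← Real.rpow_mul (by norm_num)]
    norm_num
  refine ⟨by linarith, ?_⟩
  rw [le_inv_comm₀ (by norm_num) (by linarith)]
  linarith

theorem mainTheorem4 (f : Octonion → Octonion)
    (hf : InnerProductSpace.HarmonicOnNhd f (Metric.ball (0 : Octonion) 1))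
    (hbound : ∀ x ∈ Metric.ball (0 : Octonion) 1, ‖f x‖ ≤ 1)
    (a : Octonion) (ha : a ∈ Metric.ball (0 : Octonion) 1) (hfa : f a = 0) :
    ∀ x ∈ Metric.ball (0 : Octonion) 1,
      ‖f x‖ ≤ (1 + ‖a‖) ^ 6 / ((2 : ℝ) ^ (1 / 8 : ℝ) - 1) *
        (‖x - a‖ / ‖1 - star a * x‖ ^ 7) := by
  intro x hx
  rcases eq_or_ne (f x) 0 with hfx | hfx
  · rw [hfx, norm_zero]
    have := ten_le_inv_two_rpow_sub_one.1
    positivity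
  have hfx' : ‖f x‖ ≠ 0 := norm_ne_zero_iff.2 hfx
  -- For this `w`, `⟪w, f⟫` is bounded by `1` on the ball and equals `‖f x‖` at `x`, so nothing is
  -- lost.
  set w : Octonion := ‖f x‖⁻¹ • f x with hw
  have hw1 : ‖w‖ = 1 := by rw [hw, norm_smul, norm_inv, norm_norm, inv_mul_cancel₀ hfx']
  have key := abs_le_of_harmonicOnNhd_of_apply_eq_zero Octonion.finrank_eq
    (hf.comp_CLM (innerSL ℝ w)) (fun z hz => ?_) ha (by simp [hfa]) hx (norm_nonneg _)
    (Octonion.norm_one_sub_star_mul_sq a x)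
  · have h1 : (innerSL ℝ w ∘ f) x = ‖f x‖ := by
      simp only [Function.comp_apply, innerSL_apply_apply, hw, inner_smul_left,
        real_inner_self_eq_norm_sq, conj_trivial]
      field_simp
    rw [h1, abs_norm] at key
    refine key.trans ?_
    rw [div_eq_mul_inv ((1 + ‖a‖) ^ 6), mul_comm (10 : ℝ)]
    have := ten_le_inv_two_rpow_sub_one.2
    gcongr
  · have h1 := abs_real_inner_le_norm w (f z)
    rw [hw1, one_mul] at h1
    simpa using h1.trans (hbound z hz)
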